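/- A trinity is a triangulation (multiple edges allowed) of a connected closed oriented surface whose vertices are coloured red, green and blue so that no edge joins two vertices of the same colour; write $R$, $E$, $V$ for the sets of red, green and blue vertices. An edge has the colour missing at its two endpoints. A triangle is black if the vertex colours blue, green, red follow each other clockwise around it, and white otherwise; every edge separates a white from a black triangle. A planar trinity is a trinity on the sphere with a chosen white triangle, called outer; the vertices of the outer triangle are called the roots. For $X\in\{R,E,V\}$ let $G_X^*$ be the directed graph with vertex set $X$ that has one arrow for each edge $\epsilon$ opposite to vertices of the colour of $X$: the arrow starts at the vertex in $X$ of the black triangle adjacent to $\epsilon$, crosses $\epsilon$, and ends at the vertex in $X$ of the white triangle adjacent to $\epsilon$. Thus the arrows of $G_X^*$ correspond to the white triangles. The graph $G_X^*$ is embedded in the oriented sphere, and its root is the root of the trinity that lies in $X$. A spanning arborescence of $G_X^*$ is a spanning tree all of whose edges point away from the root. The clocked arborescence of $G_X^*$ is the set of arrows selected by the following greedy search. Start at the root, at the corner of the outer triangle, with no arrow selected, and turn counter-clockwise around the root, looking at the ends of arrows one by one. Whenever the tail of an arrow is met whose end point has not been reached yet (it is neither the root nor the end point of a selected arrow), select this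 arrow, go along it, and continue turning counter-clockwise around its end point, beginning just after the selected arrow. When a full turn has been made at a vertex other than the root, backtrack along the selected arrow that ends there and continue turning at its starting point. All other arrow ends are passed over. A Tutte matching of a planar trinity is a perfect matching between the non-outer white triangles and the non-root vertices (of all three colours) in which every triangle is matched to one of its own vertices. Theorem. Let $\mathcal T$ be a planar trinity. The clocked arborescences of $G_R^*$, $G_E^*$ and $G_V^*$ are spanning arborescences of these graphs. View each of them as a matching between white triangles and vertices of the respective colour, by matching the white triangle that an arrow crosses to the vertex at which the arrow ends. Then the union of these three matchings is a Tutte matching of $\mathcal T$. -/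

import Mathlib

/-- The three colours. -/
inductive Colour : Type
  | red
  | green
  | blue
  deriving DecidableEq

namespace Colour

instance : Fintype Colour := ⟨{red, green, blue}, fun c => by cases c <;> simp⟩

/-- Going counter-clockwise around a white triangle, its vertices are red, blue, green, in this
cyclic order; `c.next` is the colour that follows `c`. (Around a black triangle the counter-clockwise
order is red, green, blue.) -/
def next : Colour → Colour
  | red => blue
  | blue => green
  | green => red

/-- The colour that precedes `c` in the cyclic order red, blue, green. -/
def prev : Colour → Colour
  | red => green
  | green => blue
  | blue => red

end Colour

/-- A trinity: a triangulation of a connected, closed, oriented surface with vertices properly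
coloured red, green, blue, given by its gluing pattern. `W` and `B` are the sets of white and black
triangles. Each triangle has one vertex and one edge of every colour; the edge of colour `c` is the
one opposite to the vertex of colour `c`. Each edge of the triangulation lies between a white and a
black triangle, and `cross c w` is the black triangle on the other side of the edge of colour `c`
of the white triangle `w`; an edge is determined by its colour and the white triangle next to it.
(Multiple edges are allowed.) -/
structure Trinity (W B : Type*) where
  cross : Colour → W ≃ B
  /-- The surface is connected: one can get from any triangle to any other across edges. -/
  connected : ∀ s t : W ⊕ B,
    Relation.EqvGen (fun x y => ∃ c w, x = Sum.inl w ∧ y = Sum.inr (cross c w)) s t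

namespace Trinity

variable {W B : Type*} (T : Trinity W B)

/-- Every triangle has exactly one corner at a vertex of colour `c`. `T.rot c` takes each triangle to
the next one in the counter-clockwise direction around its vertex of colour `c`.
At the vertex of colour `c`, a white triangle is left counter-clockwise through its edge of colour
`c.next`, and a black triangle through its edge of colour `c.prev`. -/
def rot (c : Colour) : Equiv.Perm (W ⊕ B) where
  toFun := Sum.elim (fun w => Sum.inr (T.cross c.next w)) (fun b => Sum.inl ((T.cross c.prev).symm b))
  invFun := Sum.elim (fun w => Sum.inr (T.cross c.prev w)) (fun b => Sum.inl ((T.cross c.next).symm b))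
  left_inv := by rintro (w | b) <;> simp
  right_inv := by rintro (w | b) <;> simp

/-- The vertices of colour `c`: two triangles share their vertex of colour `c` when one can be
rotated into the other about it. -/
def Vertex (c : Colour) : Type _ :=
  Quotient (Equiv.Perm.SameCycle.setoid (T.rot c))

/-- The vertex of colour `c` of a triangle. -/
def vertexOf (c : Colour) (t : W ⊕ B) : T.Vertex c :=
  Quotient.mk (Equiv.Perm.SameCycle.setoid (T.rot c)) t

/-- The set of all vertices of the trinity. -/
abbrev AnyVertex : Type _ := (c : Colour) × T.Vertex c

/-- Euler characteristic: vertices minus edges plus triangles. -/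
noncomputable def eulerChar : ℤ :=
  (Nat.card T.AnyVertex : ℤ) - (Nat.card (Colour × W) : ℤ) + (Nat.card (W ⊕ B) : ℤ)

/- The directed graph `G_c^*`: its vertices are the vertices of colour `c`, and it has one arrow for
each edge of colour `c`, that is, one arrow for each white triangle `w`. That arrow starts at the
vertex of colour `c` of the black triangle `T.cross c w`, crosses the edge of colour `c` of `w`, and
ends at the vertex of colour `c` of `w`. -/

/-- The end point of the arrow of `G_c^*` that lies across the white triangle `w`. -/
def head (c : Colour) (w : W) : T.Vertex c := T.vertexOf c (Sum.inl w)

/-- The starting point of the arrow of `G_c^*` that lies across the white triangle `w`. -/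
def tail (c : Colour) (w : W) : T.Vertex c := T.vertexOf c (Sum.inr (T.cross c w))

/- Around a vertex of colour `c`, each white triangle contains the head end of exactly one arrow of
`G_c^*` and each black triangle contains the tail end of exactly one. So the half-edges of the
ribbon graph `G_c^*` are the elements of `W ⊕ B`, and `T.rot c` is the counter-clockwise cyclic
ordering of the half-edges around each vertex. -/

/-- The arrow of `G_c^*` to which a half-edge belongs. -/
def arrowOf (c : Colour) : W ⊕ B → W :=
  Sum.elim id (T.cross c).symm

/-- The other half of the same arrow of `G_c^*`. -/
def opposite (c : Colour) : W ⊕ B → W ⊕ B :=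
  Sum.elim (fun w => Sum.inr (T.cross c w)) (fun b => Sum.inl ((T.cross c).symm b))

open Classical in
/-- One step of the counter-clockwise tour around the perimeter of the subgraph of `G_c^*` with
arrow set `A`: on meeting an arrow of `A` we go along it and turn on at its other end point,
and an arrow outside `A` is passed over. -/
noncomputable def perimeterStep (c : Colour) (A : Set W) (h : W ⊕ B) : W ⊕ B :=
  if T.arrowOf c h ∈ A then T.rot c (T.opposite c h) else T.rot c h

end Trinity

/-- A planar trinity: a trinity on the sphere with a chosen outer white triangle. -/
structure PlanarTrinity (W B : Type*) extends Trinity W B where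
  outer : W
  spherical : toTrinity.eulerChar = 2

namespace PlanarTrinity

variable {W B : Type*} (T : PlanarTrinity W B)

/-- The roots are the vertices of the outer white triangle. -/
def root (c : Colour) : T.Vertex c := T.vertexOf c (Sum.inl T.outer)

/-- A set `A` of arrows of `G_c^*` is a spanning arborescence: no arrow of `A` ends at the root,
exactly one ends at every other vertex, and every vertex can be reached from the root by a directed
path in `A`. -/
def IsSpanningArborescence (c : Colour) (A : Set W) : Prop :=
  (∀ w ∈ A, T.head c w ≠ T.root c) ∧
  (∀ v : T.Vertex c, v ≠ T.root c → ∃! w, w ∈ A ∧ T.head c w = v) ∧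
  (∀ v : T.Vertex c,
    Relation.ReflTransGen (fun x y => ∃ w ∈ A, T.tail c w = x ∧ T.head c w = y) (T.root c) v)

/-- Selection of an arrow in the greedy search: if the search, having selected the arrows `A`, stands
at the half-edge `h`, and `h` is the tail end of an arrow whose end point is neither the root nor
the end point of an arrow in `A`, then that arrow is added to `A`. -/
def select (c : Colour) (A : Set W) (h : W ⊕ B) : Set W :=
  A ∪ {w | h = Sum.inr (T.cross c w) ∧ T.head c w ≠ T.root c ∧
    ∀ w' ∈ A, T.head c w' ≠ T.head c w}

/-- The greedy search in `G_c^*`: the arrows selected and the half-edge at which we stand after `k`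
steps. The search starts at the root inside the outer triangle and turns counter-clockwise. When an
arrow is selected, the search continues at its end point; when a full turn has been made at a
vertex, the arrow leading to that vertex is met again, and the search backtracks along it. -/
noncomputable def search (c : Colour) : ℕ → Set W × (W ⊕ B)
  | 0 => (∅, Sum.inl T.outer)
  | k + 1 =>
    (T.select c (search c k).1 (search c k).2,
      T.perimeterStep c (T.select c (search c k).1 (search c k).2) (search c k).2)

/-- The clocked arborescence of `G_c^*`: the set of arrows selected by the greedy search. -/
def clocked (c : Colour) : Set W := {w | ∃ k, w ∈ (T.search c k).1}

/-- A set of arrows of `G_c^*` viewed as a matching between white triangles and vertices of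
colour `c`: each white triangle crossed by an arrow is matched to the vertex where it ends. -/
def asMatching (c : Colour) (A : Set W) : Set (W × T.AnyVertex) :=
  {p | ∃ w ∈ A, p = (w, ⟨c, T.head c w⟩)}

/-- A Tutte matching: a perfect matching between the non-outer white triangles and the non-root
vertices in which triangles are matched to incident vertices. -/
def IsTutteMatching (M : Set (W × T.AnyVertex)) : Prop :=
  (∀ p ∈ M, p.1 ≠ T.outer ∧ p.2.2 ≠ T.root p.2.1 ∧ T.vertexOf p.2.1 (Sum.inl p.1) = p.2.2) ∧
  (∀ w : W, w ≠ T.outer → ∃! v : T.AnyVertex, (w, v) ∈ M) ∧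
  (∀ v : T.AnyVertex, v.2 ≠ T.root v.1 → ∃! w : W, (w, v) ∈ M)

end PlanarTrinity

/-! Fix a colour `c`. The search in `G_c^*` is the counter-clockwise tour around the perimeter of
the arborescence it ends with, and it visits every half-edge; `time` records the first visits. These
times extend the arborescence to a colouring `matchColour c` of all white triangles: an unselected
triangle goes to one of its two other vertices, according to which end of its arrow is met first.
Every non-root vertex is hit, and Euler's formula gives as many non-root vertices as non-outer white
triangles, so this is a Tutte matching (`isMatching_matchColour`).

It remains to see that the three Tutte matchings coincide (`matchColour_eq`): then the three clocked
arborescences are the colour classes of a single one. The difference of two of them is a source-free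
flow on the corners, and on a sphere such a flow is the difference of a height function on the black
triangles (`exists_potential`). The region above the height at the outer triangle is entered,
counter-clockwise around vertices, only at corners of the first matching, and the region below only
at corners of the second. By `eq_empty_of_entering` such a region is empty for a clocked matching:
otherwise, starting at its first black triangle, one finds corners at ever earlier times. So the
height is constant and the matchings agree. -/

namespace Colour

@[simp] theorem next_next (c : Colour) : c.next.next = c.prev := by cases c <;> rfl
@[simp] theorem prev_prev (c : Colour) : c.prev.prev = c.next := by cases c <;> rfl
@[simp] theorem next_prev (c : Colour) : c.next.prev = c := by cases c <;> rfl
@[simp] theorem prev_next (c : Colour) : c.prev.next = c := by cases c <;> rfl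
@[simp] theorem next_ne (c : Colour) : c.next ≠ c := by cases c <;> decide
@[simp] theorem prev_ne (c : Colour) : c.prev ≠ c := by cases c <;> decide
@[simp] theorem next_ne_prev (c : Colour) : c.next ≠ c.prev := by cases c <;> decide

theorem eq_or_eq_next_or_eq_prev (c d : Colour) : d = c ∨ d = c.next ∨ d = c.prev := by
  cases c <;> cases d <;> simp [next, prev]

end Colour

/-- If `τ` agrees with `σ` except that the values at `x` and `y` are exchanged, and `x` and `y` lie
on different cycles of `σ`, then these two cycles are joined to one cycle of `τ`. -/
theorem Equiv.Perm.sameCycle_of_swapped {α : Type*} [Finite α] {σ τ : Equiv.Perm α} {x y : α}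
    (hxy : ¬ σ.SameCycle x y) (hx : τ x = σ y) (hy : τ y = σ x)
    (h : ∀ z, z ≠ x → z ≠ y → τ z = σ z) {z : α} (hz : σ.SameCycle x z ∨ σ.SameCycle y z) :
    τ.SameCycle x z := by
  have key : ∀ a b : α, ¬ σ.SameCycle a b → τ a = σ b →
      (∀ z, z ≠ a → z ≠ b → τ z = σ z) → ∀ z, σ.SameCycle b z → τ.SameCycle a z := by
    intro a b hab ha h z hbz
    have : ∀ n : ℕ, τ.SameCycle a ((σ ^ n) (σ b)) := by
      intro n
      induction n with
      | zero => simpa [← ha] using Equiv.Perm.SameCycle.refl τ a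
      | succ n ih =>
        rw [pow_succ', Equiv.Perm.mul_apply]
        -- `τ` follows `σ` along the cycle of `b`, which avoids `a`. Once `b` is met, the next value
        -- `σ b = τ a` already lies on the cycle.
        by_cases e : (σ ^ n) (σ b) = b
        · rw [e, ← ha]; simpa using Equiv.Perm.SameCycle.refl τ a
        · rw [← h _ ?_ e]
          · simpa using ih
          · intro e'
            apply hab
            rw [← e']
            simpa using (Equiv.Perm.SameCycle.refl σ b)
    have hz : σ.SameCycle (σ b) z := by simpa using hbz
    obtain ⟨n, -, hn⟩ := hz.exists_pow_eq'
    exact hn ▸ this n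
  have hxy' : τ.SameCycle x y := key x y hxy hx h y (.refl _ _)
  rcases hz with hz | hz
  · exact hxy'.trans (key y x (fun e => hxy e.symm) hy (fun z h1 h2 => h z h2 h1) z hz)
  · exact key x y hxy hx h z hz

/-! ### Incidences, balance around vertices, and tours. -/

namespace Trinity

variable {W B : Type*} (T : Trinity W B)

/-- A property that is passed on across all edges is shared by all triangles. -/
theorem eq_of_cross_invariant {α : Type*} (F : W ⊕ B → α)
    (hF : ∀ c w, F (Sum.inl w) = F (Sum.inr (T.cross c w))) (s t : W ⊕ B) : F s = F t := by
  induction T.connected s t with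
  | rel x y h => obtain ⟨c, w, rfl, rfl⟩ := h; exact hF c w
  | refl x => rfl
  | symm x y _ ih => exact ih.symm
  | trans x y z _ _ h1 h2 => exact h1.trans h2

@[simp] theorem rot_inl (c : Colour) (w : W) :
    T.rot c (Sum.inl w) = Sum.inr (T.cross c.next w) := rfl
@[simp] theorem rot_inr (c : Colour) (b : B) :
    T.rot c (Sum.inr b) = Sum.inl ((T.cross c.prev).symm b) := rfl
@[simp] theorem arrowOf_inl (c : Colour) (w : W) : T.arrowOf c (Sum.inl w) = w := rfl
@[simp] theorem arrowOf_inr (c : Colour) (b : B) :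
    T.arrowOf c (Sum.inr b) = (T.cross c).symm b := rfl
@[simp] theorem opposite_inl (c : Colour) (w : W) :
    T.opposite c (Sum.inl w) = Sum.inr (T.cross c w) := rfl
@[simp] theorem opposite_inr (c : Colour) (b : B) :
    T.opposite c (Sum.inr b) = Sum.inl ((T.cross c).symm b) := rfl

@[simp] theorem vertexOf_rot (c : Colour) (t : W ⊕ B) :
    T.vertexOf c (T.rot c t) = T.vertexOf c t :=
  Quotient.sound (s := Equiv.Perm.SameCycle.setoid (T.rot c))
    (Equiv.Perm.sameCycle_apply_left.2 (.refl _ _))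

theorem vertexOf_eq_iff {c : Colour} {s t : W ⊕ B} :
    T.vertexOf c s = T.vertexOf c t ↔ (T.rot c).SameCycle s t :=
  Quotient.eq (r := Equiv.Perm.SameCycle.setoid (T.rot c))

theorem vertexOf_cross {c d : Colour} (h : d ≠ c) (w : W) :
    T.vertexOf c (Sum.inr (T.cross d w)) = T.vertexOf c (Sum.inl w) := by
  rcases c.eq_or_eq_next_or_eq_prev d with rfl | rfl | rfl
  · exact absurd rfl h
  · exact T.vertexOf_rot c (Sum.inl w)
  · simpa using (T.vertexOf_rot c (Sum.inr (T.cross c.prev w))).symm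

theorem exists_white_vertexOf {c : Colour} (v : T.Vertex c) :
    ∃ w, T.vertexOf c (Sum.inl w) = v := by
  induction v using Quotient.inductionOn with
  | h t =>
    rcases t with w | b
    · exact ⟨w, rfl⟩
    · refine ⟨(T.cross c.next).symm b, ?_⟩
      rw [← T.vertexOf_cross c.next_ne, Equiv.apply_symm_apply]; rfl

instance [Finite W] [Finite B] (c : Colour) : Finite (T.Vertex c) :=
  inferInstanceAs (Finite (Quotient _))

/-- Around a set of vertices of colour `c`, there are as many triangles of a set `S` of black
triangles on one side of the white triangles as on the other side. -/
theorem ncard_next_eq_ncard_prev {c d d' : Colour} (hd : d ≠ c) (hd' : d' ≠ c)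
    (X : Set (T.Vertex c)) (S : Set B) :
    {w | T.vertexOf c (Sum.inl w) ∈ X ∧ T.cross d w ∈ S}.ncard =
      {w | T.vertexOf c (Sum.inl w) ∈ X ∧ T.cross d' w ∈ S}.ncard := by
  have key : ∀ d, d ≠ c → {w | T.vertexOf c (Sum.inl w) ∈ X ∧ T.cross d w ∈ S}.ncard =
      {b | T.vertexOf c (Sum.inr b) ∈ X ∧ b ∈ S}.ncard := by
    intro d hd
    rw [← Set.ncard_image_of_injective _ (T.cross d).injective]
    congr 1
    ext b
    constructor
    · rintro ⟨w, ⟨h1, h2⟩, rfl⟩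
      exact ⟨by rwa [T.vertexOf_cross hd], h2⟩
    · rintro ⟨h1, h2⟩
      refine ⟨(T.cross d).symm b, ⟨?_, by simpa using h2⟩, by simp⟩
      rw [← T.vertexOf_cross hd]; simpa using h1
  rw [key d hd, key d' hd']

/-- If `S` is left at some corner of a vertex, then it is entered at another one. -/
theorem exists_entering_of_leaving [Finite W] {c : Colour} {S : Set B} {w : W}
    (h1 : T.cross c.prev w ∈ S) (h2 : T.cross c.next w ∉ S) :
    ∃ w', T.vertexOf c (Sum.inl w') = T.vertexOf c (Sum.inl w) ∧
      T.cross c.next w' ∈ S ∧ T.cross c.prev w' ∉ S := by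
  by_contra! hcon
  have := Set.eq_of_subset_of_ncard_le
    (s := {w' | T.vertexOf c (Sum.inl w') ∈ ({T.vertexOf c (Sum.inl w)} : Set _) ∧
      T.cross c.next w' ∈ S})
    (t := {w' | T.vertexOf c (Sum.inl w') ∈ ({T.vertexOf c (Sum.inl w)} : Set _) ∧
      T.cross c.prev w' ∈ S}) (fun w' h => ⟨h.1, hcon w' h.1 h.2⟩)
    (T.ncard_next_eq_ncard_prev c.prev_ne c.next_ne _ S).le (Set.toFinite _)
  have hw : w ∈ {w' | T.vertexOf c (Sum.inl w') ∈ ({T.vertexOf c (Sum.inl w)} : Set _) ∧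
      T.cross c.prev w' ∈ S} := ⟨rfl, h1⟩
  rw [← this] at hw
  exact h2 hw.2

/-- `G_c^*` is strongly connected: a nonempty set of vertices that no arrow leaves is everything. -/
theorem mem_of_closed [Finite W] {c : Colour} {X : Set (T.Vertex c)} {v₀ : T.Vertex c}
    (h₀ : v₀ ∈ X) (hX : ∀ w, T.tail c w ∈ X → T.head c w ∈ X) (v : T.Vertex c) : v ∈ X := by
  -- Heads and tails alternate around each vertex, so both sides count the black triangles with
  -- vertex in `X`. As no arrow leaves `X`, none enters it either.
  have hcard : {w | T.head c w ∈ X}.ncard = {w | T.tail c w ∈ X}.ncard := by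
    have h1 := Set.ncard_image_of_injective {w | T.head c w ∈ X} (T.cross c.next).injective
    have h2 := Set.ncard_image_of_injective {w | T.tail c w ∈ X} (T.cross c).injective
    rw [← h1, ← h2]
    congr 1
    ext b
    constructor
    · rintro ⟨w, h, rfl⟩
      refine ⟨(T.cross c).symm (T.cross c.next w), ?_, by simp⟩
      simp only [tail, Set.mem_ofPred_eq, Equiv.apply_symm_apply]
      rwa [T.vertexOf_cross c.next_ne]
    · rintro ⟨w, h, rfl⟩
      refine ⟨(T.cross c.next).symm (T.cross c w), ?_, by simp⟩
      simp only [head, Set.mem_ofPred_eq]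
      rw [← T.vertexOf_cross c.next_ne]
      simpa [tail] using h
  have heq := Set.eq_of_subset_of_ncard_le (s := {w | T.tail c w ∈ X}) (t := {w | T.head c w ∈ X})
    hX hcard.le (Set.toFinite _)
  have hinv := T.eq_of_cross_invariant (fun t => T.vertexOf c t ∈ X) (fun d w => by
    by_cases hd : d = c
    · subst hd
      exact propext (Set.ext_iff.1 heq w).symm
    · simp only [T.vertexOf_cross hd])
  induction v using Quotient.inductionOn with
  | h t =>
    induction v₀ using Quotient.inductionOn with
    | h s => exact (hinv s t).mp h₀

@[simp] theorem arrowOf_opposite (c : Colour) (h : W ⊕ B) :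
    T.arrowOf c (T.opposite c h) = T.arrowOf c h := by
  rcases h with w | b <;> simp

@[simp] theorem opposite_opposite (c : Colour) (h : W ⊕ B) :
    T.opposite c (T.opposite c h) = h := by
  rcases h with w | b <;> simp

open Classical in
/-- The tour around the perimeter of a set of arrows, as a permutation of the half-edges. -/
noncomputable def perimeterPerm (c : Colour) (A : Set W) : Equiv.Perm (W ⊕ B) :=
  (Function.Involutive.toPerm (fun h => if T.arrowOf c h ∈ A then T.opposite c h else h) (by
    intro h; by_cases hA : T.arrowOf c h ∈ A <;> simp [hA])).trans (T.rot c)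

theorem perimeterPerm_apply (c : Colour) (A : Set W) (h : W ⊕ B) :
    T.perimeterPerm c A h = T.perimeterStep c A h := by
  change T.rot c (@ite _ _ (Classical.propDecidable _) _ _) = _
  unfold perimeterStep
  split_ifs <;> rfl

theorem perimeterStep_congr {c : Colour} {A A' : Set W} {h : W ⊕ B}
    (hA : T.arrowOf c h ∈ A ↔ T.arrowOf c h ∈ A') :
    T.perimeterStep c A h = T.perimeterStep c A' h := by
  by_cases h' : T.arrowOf c h ∈ A'
  · simp only [perimeterStep, hA.2 h', h', if_true]
  · simp only [perimeterStep, mt hA.1 h', h', if_false]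

/-- How the tour arrives at a black triangle. -/
theorem eq_of_perimeterStep_eq_inr {c : Colour} {A : Set W} {h : W ⊕ B} {w : W}
    (e : T.perimeterStep c A h = Sum.inr (T.cross c.next w)) :
    (w ∈ A ∧ h = Sum.inr (T.cross c w)) ∨ (w ∉ A ∧ h = Sum.inl w) := by
  rw [← T.rot_inl] at e
  by_cases hA : T.arrowOf c h ∈ A
  · simp only [perimeterStep, hA, if_true, EmbeddingLike.apply_eq_iff_eq] at e
    left
    rw [← T.opposite_opposite c h, e]
    rw [← arrowOf_opposite, e] at hA
    exact ⟨hA, rfl⟩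
  · simp only [perimeterStep, hA, if_false, EmbeddingLike.apply_eq_iff_eq] at e
    subst e
    exact Or.inr ⟨hA, rfl⟩

/-- How the tour arrives at a white triangle. -/
theorem eq_of_perimeterStep_eq_inl {c : Colour} {A : Set W} {h : W ⊕ B} {w : W}
    (e : T.perimeterStep c A h = Sum.inl w) :
    ∃ w', T.cross c w' = T.cross c.prev w ∧
      ((w' ∈ A ∧ h = Sum.inl w') ∨ (w' ∉ A ∧ h = Sum.inr (T.cross c w'))) := by
  have e' : T.perimeterStep c A h = T.rot c (Sum.inr (T.cross c.prev w)) := by simpa using e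
  refine ⟨(T.cross c).symm (T.cross c.prev w), by simp, ?_⟩
  by_cases hA : T.arrowOf c h ∈ A
  · simp only [perimeterStep, hA, if_true, EmbeddingLike.apply_eq_iff_eq] at e'
    left
    rw [← T.opposite_opposite c h, e']
    rw [← arrowOf_opposite, e'] at hA
    exact ⟨hA, rfl⟩
  · simp only [perimeterStep, hA, if_false, EmbeddingLike.apply_eq_iff_eq] at e'
    subst e'
    exact Or.inr ⟨hA, by simp⟩

end Trinity

/-! ### The search as a tour around the clocked arborescence. -/

namespace PlanarTrinity

open Trinity

variable {W B : Type*} (T : PlanarTrinity W B)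

/-- The vertices that have been reached when the arrows in `A` are selected. -/
def Reached (c : Colour) (A : Set W) (v : T.Vertex c) : Prop :=
  v = T.root c ∨ ∃ w ∈ A, T.head c w = v

/-- The set of arrows selected in the first `k` steps of the search. -/
noncomputable def arrows (c : Colour) (k : ℕ) : Set W := (T.search c k).1

/-- The half-edge at which the search stands after `k` steps. -/
noncomputable def pos (c : Colour) (k : ℕ) : W ⊕ B := (T.search c k).2

variable {T} {c : Colour}

theorem Reached.mono {A A' : Set W} (h : A ⊆ A') {v : T.Vertex c} (hv : T.Reached c A v) :
    T.Reached c A' v :=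
  hv.imp_right fun ⟨w, hw, e⟩ => ⟨w, h hw, e⟩

theorem arrows_zero : T.arrows c 0 = ∅ := rfl

theorem pos_zero : T.pos c 0 = Sum.inl T.outer := rfl

theorem mem_arrows_succ {k : ℕ} {w : W} :
    w ∈ T.arrows c (k + 1) ↔ w ∈ T.arrows c k ∨
      (T.pos c k = Sum.inr (T.cross c w) ∧ ¬ T.Reached c (T.arrows c k) (T.head c w)) := by
  change w ∈ T.select c (T.arrows c k) (T.pos c k) ↔ _
  simp [select, Reached]

theorem pos_succ {k : ℕ} :
    T.pos c (k + 1) = T.perimeterStep c (T.arrows c (k + 1)) (T.pos c k) := rfl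

theorem mem_clocked {w : W} : w ∈ T.clocked c ↔ ∃ k, w ∈ T.arrows c k := Iff.rfl

theorem arrows_mono : Monotone (T.arrows c) :=
  monotone_nat_of_le_succ fun _ _ hw => mem_arrows_succ.2 (Or.inl hw)

theorem arrows_subset_clocked (k : ℕ) : T.arrows c k ⊆ T.clocked c := fun _ hw => ⟨k, hw⟩

theorem reached_perimeterStep {A : Set W} (hA : ∀ w ∈ A, T.Reached c A (T.tail c w))
    {h : W ⊕ B} (hh : T.Reached c A (T.vertexOf c h)) :
    T.Reached c A (T.vertexOf c (T.perimeterStep c A h)) := by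
  by_cases ha : T.arrowOf c h ∈ A
  · simp only [perimeterStep, ha, if_true, vertexOf_rot]
    rcases h with w | b
    · exact hA w ha
    · exact Or.inr ⟨_, ha, rfl⟩
  · simpa only [perimeterStep, ha, if_false, vertexOf_rot] using hh

theorem reached_invariant (k : ℕ) : T.Reached c (T.arrows c k) (T.vertexOf c (T.pos c k)) ∧
    ∀ w ∈ T.arrows c k, T.Reached c (T.arrows c k) (T.tail c w) := by
  induction k with
  | zero => exact ⟨Or.inl rfl, fun w hw => by simp [arrows_zero] at hw⟩
  | succ k ih =>
    have hsub : T.arrows c k ⊆ T.arrows c (k + 1) := arrows_mono k.le_succ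
    have h2 : ∀ w ∈ T.arrows c (k + 1), T.Reached c (T.arrows c (k + 1)) (T.tail c w) := by
      intro w hw
      rcases mem_arrows_succ.1 hw with hw | ⟨hp, -⟩
      · exact (ih.2 w hw).mono hsub
      · have := ih.1
        rw [hp] at this
        exact this.mono hsub
    exact ⟨reached_perimeterStep h2 (ih.1.mono hsub), h2⟩

theorem reached_pos (k : ℕ) : T.Reached c (T.arrows c k) (T.vertexOf c (T.pos c k)) :=
  (reached_invariant k).1

theorem reached_tail {k : ℕ} {w : W} (hw : w ∈ T.arrows c k) :
    T.Reached c (T.arrows c k) (T.tail c w) :=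
  (reached_invariant k).2 w hw

theorem exists_selected {k : ℕ} {w : W} (hw : w ∈ T.arrows c k) :
    ∃ j < k, T.pos c j = Sum.inr (T.cross c w) ∧ ¬ T.Reached c (T.arrows c j) (T.head c w) ∧
      w ∈ T.arrows c (j + 1) := by
  induction k with
  | zero => simp [arrows_zero] at hw
  | succ k ih =>
    rcases mem_arrows_succ.1 hw with hw' | ⟨h1, h2⟩
    · obtain ⟨j, hj, h⟩ := ih hw'
      exact ⟨j, hj.trans k.lt_succ_self, h⟩
    · exact ⟨k, k.lt_succ_self, h1, h2, hw⟩

/-- Before an arrow is selected its end point is unreached, so the search cannot stand at its head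
end, and meeting its tail end selects it at once. Hence the final set of arrows already dictates
every step. -/
theorem arrowOf_pos_mem_iff (k : ℕ) :
    T.arrowOf c (T.pos c k) ∈ T.arrows c (k + 1) ↔ T.arrowOf c (T.pos c k) ∈ T.clocked c := by
  refine ⟨fun h => arrows_subset_clocked _ h, fun ⟨K, hK⟩ => ?_⟩
  obtain ⟨j, -, -, hr, hm⟩ := exists_selected hK
  rcases le_or_gt j k with hjk | hjk
  · exact arrows_mono (Nat.succ_le_succ hjk) hm
  · have hsub : T.arrows c k ⊆ T.arrows c j := arrows_mono hjk.le
    have hpos := reached_pos (T := T) (c := c) k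
    cases e : T.pos c k with
    | inl w =>
      rw [e] at hr hpos
      exact absurd (hpos.mono hsub) hr
    | inr b =>
      rw [e] at hr
      refine mem_arrows_succ.2 (Or.inr ⟨by simp [e], fun h => hr (h.mono hsub)⟩)

theorem pos_succ' (k : ℕ) :
    T.pos c (k + 1) = T.perimeterStep c (T.clocked c) (T.pos c k) := by
  rw [pos_succ, T.perimeterStep_congr (arrowOf_pos_mem_iff k)]

theorem pos_eq_pow (k : ℕ) :
    T.pos c k = (T.perimeterPerm c (T.clocked c) ^ k) (Sum.inl T.outer) := by
  induction k with
  | zero => rfl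
  | succ k ih => rw [pos_succ', ih, pow_succ', Equiv.Perm.mul_apply, perimeterPerm_apply]

theorem head_ne_root_of_mem_clocked {w : W} (hw : w ∈ T.clocked c) : T.head c w ≠ T.root c := by
  obtain ⟨k, hk⟩ := hw
  obtain ⟨j, -, -, hr, -⟩ := exists_selected hk
  exact fun e => hr (Or.inl e)

theorem exists_arrows_eq_clocked [Finite W] : ∃ K, T.arrows c K = T.clocked c := by
  have hf : (T.clocked c).Finite := Set.toFinite _
  have : ∀ s : Set W, s.Finite → s ⊆ T.clocked c → ∃ K, s ⊆ T.arrows c K := by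
    intro s hs
    induction s, hs using Set.Finite.induction_on with
    | empty => exact fun _ => ⟨0, by simp⟩
    | @insert w s _ _ ih =>
      intro h
      obtain ⟨K, hK⟩ := ih ((Set.subset_insert _ _).trans h)
      obtain ⟨K', hK'⟩ := h (Set.mem_insert _ _)
      refine ⟨max K K', Set.insert_subset (arrows_mono (le_max_right _ _) hK')
        (hK.trans (arrows_mono (le_max_left _ _)))⟩
  obtain ⟨K, hK⟩ := this _ hf le_rfl
  exact ⟨K, (arrows_subset_clocked K).antisymm hK⟩

variable (T c) in
/-- The first time when the search stands at a half-edge. -/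
noncomputable def time (h : W ⊕ B) : ℕ := sInf {k | T.pos c k = h}

theorem time_pos_le (k : ℕ) : T.time c (T.pos c k) ≤ k :=
  Nat.sInf_le (s := {j | T.pos c j = T.pos c k}) rfl

theorem exists_select_time {w : W} (hw : w ∈ T.clocked c) :
    ∃ k, T.time c (Sum.inr (T.cross c w)) ≤ k ∧ T.pos c k = Sum.inr (T.cross c w) ∧
      ¬ T.Reached c (T.arrows c k) (T.head c w) := by
  obtain ⟨K, hK⟩ := hw
  obtain ⟨k, -, hp, hr, -⟩ := exists_selected hK
  exact ⟨k, by simpa [hp] using time_pos_le (T := T) (c := c) k, hp, hr⟩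

variable [Finite W] [Finite B]

theorem reached_of_sameCycle {A : Set W} (hA : ∀ w ∈ A, T.Reached c A (T.tail c w))
    {h h' : W ⊕ B} (hh : T.Reached c A (T.vertexOf c h))
    (hs : (T.perimeterPerm c A).SameCycle h h') : T.Reached c A (T.vertexOf c h') := by
  obtain ⟨n, -, rfl⟩ := hs.exists_pow_eq'
  clear hs
  induction n with
  | zero => simpa using hh
  | succ n ih =>
    rw [pow_succ', Equiv.Perm.mul_apply, perimeterPerm_apply]
    exact reached_perimeterStep hA ih

/-- Around a vertex that is not reached, the tour is just the rotation. -/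
theorem sameCycle_of_not_reached {A : Set W} (hA : ∀ w ∈ A, T.Reached c A (T.tail c w))
    {h h' : W ⊕ B} (hh : ¬ T.Reached c A (T.vertexOf c h))
    (hs : T.vertexOf c h = T.vertexOf c h') : (T.perimeterPerm c A).SameCycle h h' := by
  obtain ⟨n, -, rfl⟩ := (T.vertexOf_eq_iff.1 hs).exists_pow_eq'
  clear hs
  have : ∀ n : ℕ, T.vertexOf c ((T.rot c ^ n) h) = T.vertexOf c h ∧
      (T.perimeterPerm c A ^ n) h = (T.rot c ^ n) h := by
    intro n
    induction n with
    | zero => simp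
    | succ n ih =>
      rw [pow_succ', pow_succ', Equiv.Perm.mul_apply, Equiv.Perm.mul_apply, perimeterPerm_apply,
        ih.2]
      refine ⟨by rw [vertexOf_rot, ih.1], ?_⟩
      unfold perimeterStep
      rw [if_neg]
      intro hm
      rw [← ih.1] at hh
      apply hh
      rcases e : (T.rot c ^ n) h with w | b
      · rw [e] at hm
        exact Or.inr ⟨w, hm, rfl⟩
      · rw [e] at hm
        simpa [tail] using hA _ hm
  rw [← (this n).2]
  exact ⟨n, by simp⟩

/-- A newly selected arrow joins the tour of the reached part to an unreached vertex, around which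
the tour is still a plain rotation. Selecting it exchanges two values of the permutation, which
merges the two cycles. -/
theorem sameCycle_of_reached (k : ℕ) {h : W ⊕ B}
    (hh : T.Reached c (T.arrows c k) (T.vertexOf c h)) :
    (T.perimeterPerm c (T.arrows c k)).SameCycle (Sum.inl T.outer) h := by
  induction k generalizing h with
  | zero =>
    have hv : T.vertexOf c h = T.root c := by simpa [Reached, arrows_zero] using hh
    have : T.perimeterPerm c (T.arrows c 0) = T.rot c := by
      ext h
      simp [perimeterPerm_apply, perimeterStep, arrows_zero]
    rw [this]
    exact T.vertexOf_eq_iff.1 hv.symm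
  | succ k ih =>
    by_cases hsel : T.arrows c (k + 1) = T.arrows c k
    · rw [hsel] at hh ⊢
      exact ih hh
    · obtain ⟨w, hw, hw'⟩ : ∃ w ∈ T.arrows c (k + 1), w ∉ T.arrows c k := by
        by_contra! hcon
        exact hsel (Set.Subset.antisymm hcon (arrows_mono k.le_succ))
      obtain ⟨hp, hr⟩ := (mem_arrows_succ.1 hw).resolve_left hw'
      have hmem : ∀ w', w' ∈ T.arrows c (k + 1) ↔ w' ∈ T.arrows c k ∨ w' = w := by
        intro w'
        refine ⟨fun h => (mem_arrows_succ.1 h).imp_right fun h => ?_, ?_⟩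
        · have := h.1.symm.trans hp
          simpa using this
        · rintro (h | rfl)
          exacts [arrows_mono k.le_succ h, hw]
      have htail := reached_pos (T := T) (c := c) k
      rw [hp] at htail
      have hA : ∀ w ∈ T.arrows c k, T.Reached c (T.arrows c k) (T.tail c w) :=
        fun w hw => reached_tail hw
      have hxy : ¬ (T.perimeterPerm c (T.arrows c k)).SameCycle
          (Sum.inr (T.cross c w)) (Sum.inl w) :=
        fun hs => hr (reached_of_sameCycle hA htail hs)
      have key : ∀ z, (T.perimeterPerm c (T.arrows c k)).SameCycle (Sum.inr (T.cross c w)) z ∨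
          (T.perimeterPerm c (T.arrows c k)).SameCycle (Sum.inl w) z →
          (T.perimeterPerm c (T.arrows c (k + 1))).SameCycle (Sum.inr (T.cross c w)) z := by
        intro z hz
        refine Equiv.Perm.sameCycle_of_swapped hxy ?_ ?_ ?_ hz
        · simp [perimeterPerm_apply, perimeterStep, hw, hw']
        · simp [perimeterPerm_apply, perimeterStep, hw, hw']
        · intro z hz1 hz2
          have hne : T.arrowOf c z ≠ w := by
            rcases z with w' | b
            · simpa using hz2
            · simpa [Equiv.symm_apply_eq] using hz1
          have hiff := hmem (T.arrowOf c z)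
          rw [or_iff_left hne] at hiff
          rw [perimeterPerm_apply, perimeterPerm_apply, T.perimeterStep_congr hiff]
      have hroot := key (Sum.inl T.outer) (Or.inl (ih htail).symm)
      refine hroot.symm.trans (key h ?_)
      rcases hh with hh | ⟨w', hm, hh⟩
      · exact Or.inl ((ih htail).symm.trans (ih (Or.inl hh)))
      · rcases (hmem w').1 hm with hm | rfl
        · exact Or.inl ((ih htail).symm.trans (ih (Or.inr ⟨w', hm, hh⟩)))
        · exact Or.inr (sameCycle_of_not_reached hA hr hh)

theorem exists_pos_eq_of_reached {h : W ⊕ B}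
    (hh : T.Reached c (T.clocked c) (T.vertexOf c h)) : ∃ k, T.pos c k = h := by
  obtain ⟨K, hK⟩ := exists_arrows_eq_clocked (T := T) (c := c)
  rw [← hK] at hh
  have := sameCycle_of_reached K hh
  rw [hK] at this
  obtain ⟨n, -, hn⟩ := this.exists_pow_eq'
  exact ⟨n, by rw [pos_eq_pow, hn]⟩

/-- The tour meets the tail end of every arrow starting at a reached vertex, and then the end point
is reached or becomes so. Strong connectivity does the rest. -/
theorem reached_clocked (v : T.Vertex c) : T.Reached c (T.clocked c) v := by
  refine T.mem_of_closed (X := {v | T.Reached c (T.clocked c) v}) (v₀ := T.root c)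
    (Or.inl rfl) (fun w hw => ?_) v
  obtain ⟨k, hk⟩ := exists_pos_eq_of_reached (T := T) (c := c) (h := Sum.inr (T.cross c w)) hw
  by_cases hr : T.Reached c (T.arrows c k) (T.head c w)
  · exact hr.mono (arrows_subset_clocked k)
  · exact Or.inr ⟨w, ⟨k + 1, mem_arrows_succ.2 (Or.inr ⟨hk, hr⟩)⟩, rfl⟩

theorem exists_pos_eq (c : Colour) (h : W ⊕ B) : ∃ k, T.pos c k = h :=
  exists_pos_eq_of_reached (reached_clocked _)

theorem pos_time (h : W ⊕ B) : T.pos c (T.time c h) = h :=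
  Nat.sInf_mem (s := {k | T.pos c k = h}) (exists_pos_eq c h)

theorem time_perimeterStep_le (h : W ⊕ B) :
    T.time c (T.perimeterStep c (T.clocked c) h) ≤ T.time c h + 1 := by
  have := time_pos_le (T := T) (c := c) (T.time c h + 1)
  rwa [pos_succ', pos_time] at this

/-- The half-edge just before the first visit to `h` is itself new at that moment, since an earlier
visit to it would have led to `h` earlier. -/
theorem exists_perimeterStep_eq {h : W ⊕ B} (hh : h ≠ Sum.inl T.outer) :
    ∃ h', T.perimeterStep c (T.clocked c) h' = h ∧ T.time c h' + 1 = T.time c h := by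
  cases hk : T.time c h with
  | zero =>
    have := pos_time (T := T) (c := c) h
    rw [hk, pos_zero] at this
    exact absurd this.symm hh
  | succ k =>
    have h1 : T.perimeterStep c (T.clocked c) (T.pos c k) = h := by
      rw [← pos_succ', ← hk, pos_time]
    have h2 := time_perimeterStep_le (T := T) (c := c) (T.pos c k)
    have h3 := time_pos_le (T := T) (c := c) k
    rw [h1, hk] at h2
    exact ⟨_, h1, by omega⟩

/-- The search leaves along a selected arrow before it stands at the end point for the first time. -/
theorem time_tail_lt {w : W} (hw : w ∈ T.clocked c) {h : W ⊕ B}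
    (hh : T.vertexOf c h = T.head c w) : T.time c (Sum.inr (T.cross c w)) < T.time c h := by
  obtain ⟨k, hk, -, hr⟩ := exists_select_time hw
  refine hk.trans_lt (lt_of_not_ge fun hle => hr ?_)
  rw [← hh, ← pos_time (c := c) h]
  exact (reached_pos _).mono (arrows_mono hle)

/-- Among all arrows with the same end point, the selected one is met first. -/
theorem time_tail_lt_of_head_eq {w w' : W} (hw : w ∈ T.clocked c) (hne : w' ≠ w)
    (hh : T.head c w' = T.head c w) :
    T.time c (Sum.inr (T.cross c w)) < T.time c (Sum.inr (T.cross c w')) := by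
  obtain ⟨k, hk, hp, hr⟩ := exists_select_time hw
  refine hk.trans_lt (lt_of_not_ge fun hle => ?_)
  have hp' := pos_time (c := c) (T := T) (Sum.inr (T.cross c w'))
  rcases hle.eq_or_lt with e | hlt
  · rw [e, hp] at hp'
    exact hne (by simpa using hp'.symm)
  · apply hr
    rw [← hh] at hr ⊢
    exact Or.inr ⟨w', arrows_mono (Nat.succ_le_of_lt hlt) (mem_arrows_succ.2
      (Or.inr ⟨hp', fun h => hr (h.mono (arrows_mono hlt.le))⟩)), rfl⟩

theorem eq_of_mem_clocked {w w' : W} (hw : w ∈ T.clocked c) (hw' : w' ∈ T.clocked c)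
    (hh : T.head c w' = T.head c w) : w' = w := by
  by_contra hne
  have := time_tail_lt_of_head_eq hw hne hh
  have := time_tail_lt_of_head_eq hw' (Ne.symm hne) hh.symm
  omega

/-- The clocked arborescence is a spanning arborescence. -/
theorem isSpanningArborescence_clocked (c : Colour) :
    T.IsSpanningArborescence c (T.clocked c) := by
  refine ⟨fun w hw => head_ne_root_of_mem_clocked hw, fun v hv => ?_, fun v => ?_⟩
  · obtain ⟨w, hw, e⟩ := (reached_clocked v).resolve_left hv
    exact ⟨w, ⟨hw, e⟩, fun w' h => eq_of_mem_clocked hw h.1 (h.2.trans e.symm)⟩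
  · have key : ∀ k, ∀ v, T.Reached c (T.arrows c k) v → Relation.ReflTransGen
        (fun x y => ∃ w ∈ T.clocked c, T.tail c w = x ∧ T.head c w = y) (T.root c) v := by
      intro k
      induction k with
      | zero =>
        rintro v (rfl | ⟨w, hw, -⟩)
        · exact .refl
        · simp [arrows_zero] at hw
      | succ k ih =>
        rintro v (rfl | ⟨w, hw, rfl⟩)
        · exact .refl
        · rcases mem_arrows_succ.1 hw with hw' | ⟨hp, -⟩
          · exact ih _ (Or.inr ⟨w, hw', rfl⟩)
          · have := reached_pos (T := T) (c := c) k
            rw [hp] at this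
            exact (ih _ this).tail ⟨w, ⟨_, hw⟩, rfl, rfl⟩
    obtain ⟨K, hK⟩ := exists_arrows_eq_clocked (T := T) (c := c)
    exact key K v (hK ▸ reached_clocked v)

end PlanarTrinity

/-! ### A Tutte matching from one clocked arborescence. -/

namespace PlanarTrinity

open Trinity

variable {W B : Type*} {T : PlanarTrinity W B} {c : Colour}

variable (T c) in
open Classical in
/-- The colour of the vertex to which a white triangle is matched by the clocked arborescence `A` of
`G_c^*` and by the tree of the edges that do not cross `A`, directed away from the roots. -/
noncomputable def matchColour (w : W) : Colour :=
  if w ∈ T.clocked c then c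
  else if T.time c (Sum.inl w) < T.time c (Sum.inr (T.cross c w)) then c.prev else c.next

theorem matchColour_eq_self_iff {w : W} : T.matchColour c w = c ↔ w ∈ T.clocked c := by
  unfold matchColour
  split_ifs <;> simp [*]

variable (T) in
/-- The vertex of the colour `M w` of a white triangle `w`. -/
def matchVertex (M : W → Colour) (w : W) : T.AnyVertex := ⟨M w, T.vertexOf (M w) (Sum.inl w)⟩

variable (T) in
/-- A choice of a colour for every white triangle that gives a perfect matching of the non-outer
white triangles with the non-root vertices. -/
def IsMatching (M : W → Colour) : Prop :=
  Set.BijOn (T.matchVertex M) {w | w ≠ T.outer} {v | v.2 ≠ T.root v.1}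

theorem matchVertex_eq_iff {M : W → Colour} {w : W} {v : T.Vertex c} :
    T.matchVertex M w = ⟨c, v⟩ ↔ M w = c ∧ T.vertexOf c (Sum.inl w) = v := by
  unfold matchVertex
  constructor
  · intro h
    obtain ⟨h1, h2⟩ := Sigma.mk.inj_iff.1 h
    subst h1
    exact ⟨rfl, eq_of_heq h2⟩
  · rintro ⟨rfl, rfl⟩
    rfl

theorem IsMatching.vertexOf_ne_root {M : W → Colour} (hM : T.IsMatching M) {w : W}
    (hw : w ≠ T.outer) : T.vertexOf (M w) (Sum.inl w) ≠ T.root (M w) :=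
  hM.mapsTo hw

theorem IsMatching.eq_of_vertexOf_eq {M : W → Colour} (hM : T.IsMatching M) {w w' : W}
    (hw : w ≠ T.outer) (hw' : w' ≠ T.outer) (h : M w = c) (h' : M w' = c)
    (e : T.vertexOf c (Sum.inl w) = T.vertexOf c (Sum.inl w')) : w = w' :=
  hM.injOn hw hw' ((matchVertex_eq_iff.2 ⟨h, e⟩).trans (matchVertex_eq_iff.2 ⟨h', rfl⟩).symm)

variable [Finite W] [Finite B]

variable (T) in
theorem card_anyVertex : Nat.card T.AnyVertex = Nat.card W + 2 := by
  have hB : Nat.card B = Nat.card W := (Nat.card_congr (T.cross .red)).symm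
  have hC : Nat.card Colour = 3 := by rw [Nat.card_eq_fintype_card]; rfl
  have h := T.spherical
  rw [eulerChar, Nat.card_sum, Nat.card_prod, hB, hC] at h
  push_cast at h
  omega

theorem ncard_nonroot : {v : T.AnyVertex | v.2 ≠ T.root v.1}.ncard + 1 = Nat.card W := by
  have hC : Nat.card Colour = 3 := by rw [Nat.card_eq_fintype_card]; rfl
  have hV := T.card_anyVertex
  have hroot : {v : T.AnyVertex | v.2 = T.root v.1}.ncard = 3 := by
    have : {v : T.AnyVertex | v.2 = T.root v.1} =
        Set.range (fun c => (⟨c, T.root c⟩ : T.AnyVertex)) := by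
      ext ⟨c, v⟩
      constructor
      · intro h
        change v = T.root c at h
        exact ⟨c, by rw [h]⟩
      · rintro ⟨c', h⟩
        cases h
        rfl
    rw [this, ← Nat.card_coe_set_eq, Nat.card_range_of_injective, hC]
    exact fun a b h => congrArg Sigma.fst h
  have hcompl := Set.ncard_add_ncard_compl {v : T.AnyVertex | v.2 = T.root v.1}
  have hset : {v : T.AnyVertex | v.2 = T.root v.1}ᶜ = {v | v.2 ≠ T.root v.1} := rfl
  rw [hset, hroot] at hcompl
  omega

/-- A non-root vertex of colour `c.prev` is matched to the white triangle that the search passes just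
before the first black triangle at this vertex. -/
theorem exists_time_lt_black {v : T.Vertex c.prev} (hv : v ≠ T.root c.prev) :
    ∃ w, w ≠ T.outer ∧ T.vertexOf c.prev (Sum.inl w) = v ∧ T.matchColour c w = c.prev ∧
      ∀ b, T.vertexOf c.prev (Sum.inr b) = v → T.time c (Sum.inl w) < T.time c (Sum.inr b) := by
  obtain ⟨b, hb, hmin⟩ : ∃ b, T.vertexOf c.prev (Sum.inr b) = v ∧ ∀ b',
      T.vertexOf c.prev (Sum.inr b') = v → T.time c (Sum.inr b) ≤ T.time c (Sum.inr b') := by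
    obtain ⟨w, hw⟩ := T.exists_white_vertexOf v
    exact Set.exists_min_image {b | T.vertexOf c.prev (Sum.inr b) = v}
      (fun b => T.time c (Sum.inr b)) (Set.toFinite _)
      ⟨T.cross c w, (T.vertexOf_cross c.prev_ne.symm w).trans hw⟩
  obtain ⟨w, rfl⟩ := (T.cross c.next).surjective b
  rw [T.vertexOf_cross c.next_ne_prev] at hb
  obtain ⟨h', hstep, htime⟩ := exists_perimeterStep_eq (T := T) (c := c)
    (h := Sum.inr (T.cross c.next w)) (by simp)
  have hcw := hmin (T.cross c w) ((T.vertexOf_cross c.prev_ne.symm w).trans hb)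
  rcases T.eq_of_perimeterStep_eq_inr hstep with ⟨hw, rfl⟩ | ⟨hw, rfl⟩
  · omega
  · refine ⟨w, ?_, hb, ?_, fun b' hb' => ?_⟩
    · rintro rfl; exact hv hb.symm
    · rw [matchColour, if_neg hw, if_pos (by omega)]
    · have := hmin b' hb'
      omega

/-- A non-root vertex of colour `c.next` is matched to the white triangle across the black one that
the search passes just before the first white triangle at this vertex. -/
theorem exists_time_lt_white {v : T.Vertex c.next} (hv : v ≠ T.root c.next) :
    ∃ w, w ≠ T.outer ∧ T.vertexOf c.next (Sum.inl w) = v ∧ T.matchColour c w = c.next ∧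
      ∀ w', T.vertexOf c.next (Sum.inl w') = v →
        T.time c (Sum.inr (T.cross c w)) < T.time c (Sum.inl w') := by
  obtain ⟨w, hw, hmin⟩ : ∃ w, T.vertexOf c.next (Sum.inl w) = v ∧ ∀ w',
      T.vertexOf c.next (Sum.inl w') = v → T.time c (Sum.inl w) ≤ T.time c (Sum.inl w') :=
    Set.exists_min_image {w | T.vertexOf c.next (Sum.inl w) = v}
      (fun w => T.time c (Sum.inl w)) (Set.toFinite _) (T.exists_white_vertexOf v)
  obtain ⟨h', hstep, htime⟩ := exists_perimeterStep_eq (T := T) (c := c) (h := Sum.inl w) (by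
    rintro ⟨⟩; exact hv hw.symm)
  obtain ⟨w', hw', hcase⟩ := T.eq_of_perimeterStep_eq_inl hstep
  have hv' : T.vertexOf c.next (Sum.inl w') = v := by
    rw [← T.vertexOf_cross c.next_ne.symm, hw', T.vertexOf_cross c.next_ne_prev.symm, hw]
  have hcw := hmin w' hv'
  rcases hcase with ⟨hA, rfl⟩ | ⟨hA, rfl⟩
  · omega
  · refine ⟨w', ?_, hv', ?_, fun w'' hw'' => ?_⟩
    · rintro rfl; exact hv hv'.symm
    · rw [matchColour, if_neg hA, if_neg (by omega)]
    · have := hmin w'' hw''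
      omega

theorem isMatching_matchColour (c : Colour) : T.IsMatching (T.matchColour c) := by
  have hsub : {v : T.AnyVertex | v.2 ≠ T.root v.1} ⊆
      T.matchVertex (T.matchColour c) '' {w | w ≠ T.outer} := by
    rintro ⟨d, v⟩ hv
    rcases c.eq_or_eq_next_or_eq_prev d with rfl | rfl | rfl
    · obtain ⟨w, hw, e⟩ := (reached_clocked v).resolve_left hv
      refine ⟨w, ?_, matchVertex_eq_iff.2 ⟨matchColour_eq_self_iff.2 hw, e⟩⟩
      rintro rfl
      exact head_ne_root_of_mem_clocked hw rfl
    · obtain ⟨w, hw, e, hm, -⟩ := exists_time_lt_white hv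
      exact ⟨w, hw, matchVertex_eq_iff.2 ⟨hm, e⟩⟩
    · obtain ⟨w, hw, e, hm, -⟩ := exists_time_lt_black hv
      exact ⟨w, hw, matchVertex_eq_iff.2 ⟨hm, e⟩⟩
  have hcard : {w : W | w ≠ T.outer}.ncard = {v : T.AnyVertex | v.2 ≠ T.root v.1}.ncard := by
    have h1 := ncard_nonroot (T := T)
    have h2 := Set.ncard_add_ncard_compl {w : W | w = T.outer}
    have h3 : {w : W | w = T.outer}ᶜ = {w | w ≠ T.outer} := rfl
    have h4 : {w : W | w = T.outer}.ncard = 1 := Set.ncard_singleton _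
    rw [h3, h4] at h2
    omega
  have himage := Set.ncard_image_le (f := T.matchVertex (T.matchColour c))
    (Set.toFinite {w : W | w ≠ T.outer})
  have heq := Set.eq_of_subset_of_ncard_le hsub (himage.trans hcard.le) (Set.toFinite _)
  refine ⟨?_, ?_, hsub⟩
  · rw [heq]; exact Set.mapsTo_image _ _
  · exact Set.injOn_of_ncard_image_eq (by rw [← heq, hcard]) (Set.toFinite _)

theorem time_lt_black {w : W} (hw : w ≠ T.outer) (hm : T.matchColour c w = c.prev) {b : B}
    (hb : T.vertexOf c.prev (Sum.inr b) = T.vertexOf c.prev (Sum.inl w)) :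
    T.time c (Sum.inl w) < T.time c (Sum.inr b) := by
  have hr := (isMatching_matchColour (T := T) c).vertexOf_ne_root hw
  rw [hm] at hr
  obtain ⟨w', hw', e, hm', ht⟩ := exists_time_lt_black hr
  obtain rfl := (isMatching_matchColour c).eq_of_vertexOf_eq hw' hw hm' hm e
  exact ht b hb

theorem time_lt_white {w w' : W} (hw : w ≠ T.outer) (hm : T.matchColour c w = c.next)
    (he : T.vertexOf c.next (Sum.inl w') = T.vertexOf c.next (Sum.inl w)) :
    T.time c (Sum.inr (T.cross c w)) < T.time c (Sum.inl w') := by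
  have hr := (isMatching_matchColour (T := T) c).vertexOf_ne_root hw
  rw [hm] at hr
  obtain ⟨w'', hw'', e, hm', ht⟩ := exists_time_lt_white hr
  obtain rfl := (isMatching_matchColour c).eq_of_vertexOf_eq hw'' hw hm' hm e
  exact ht w' he

end PlanarTrinity

theorem Colour.sum_eq {M : Type*} [AddCommMonoid M] (f : Colour → M) :
    ∑ c, f c = f .red + (f .green + f .blue) := by
  change ∑ c ∈ {Colour.red, Colour.green, Colour.blue}, f c = _
  simp

namespace Trinity

variable {W B : Type*} (T : Trinity W B)

/-- Differences along edges of a function of the black triangles are orthogonal to sums of a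
function of the vertices and a function of the white triangles. -/
theorem sum_difference_mul_eq_zero [Fintype W] [Fintype B] (h : B → ℚ) (y : T.AnyVertex → ℚ)
    (x : W → ℚ) :
    ∑ w, ∑ c : Colour, (h (T.cross c.next w) - h (T.cross c.prev w)) *
      (y ⟨c, T.vertexOf c (Sum.inl w)⟩ + x w) = 0 := by
  have hx : ∀ w, ∑ c : Colour, (h (T.cross c.next w) - h (T.cross c.prev w)) * x w = 0 := by
    intro w
    simp only [Colour.sum_eq, Colour.next, Colour.prev]
    ring
  have hy : ∀ c : Colour, ∑ w, (h (T.cross c.next w) - h (T.cross c.prev w)) *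
      y ⟨c, T.vertexOf c (Sum.inl w)⟩ = 0 := by
    intro c
    have key : ∀ d, d ≠ c → ∑ w, h (T.cross d w) * y ⟨c, T.vertexOf c (Sum.inl w)⟩ =
        ∑ b, h b * y ⟨c, T.vertexOf c (Sum.inr b)⟩ := by
      intro d hd
      rw [← Equiv.sum_comp (T.cross d)]
      simp only [T.vertexOf_cross hd]
    simp only [sub_mul, Finset.sum_sub_distrib]
    rw [key _ c.next_ne, key _ c.prev_ne, sub_self]
  simp only [mul_add, Finset.sum_add_distrib, hx, add_zero]
  rw [Finset.sum_comm]
  simp only [hy, Finset.sum_const_zero]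

theorem eq_of_difference_eq_zero {α : Type*} {h : B → α}
    (hd : ∀ c w, h (T.cross (Colour.next c) w) = h (T.cross (Colour.prev c) w)) (b b' : B) :
    h b = h b' := by
  have hc : ∀ c w, h (T.cross c w) = h (T.cross .red w) := by
    intro c w
    have h1 := hd .green w
    have h2 := hd .blue w
    cases c
    · rfl
    · exact h2
    · exact h1.symm
  exact T.eq_of_cross_invariant (Sum.elim (fun w => h (T.cross .red w)) h)
    (fun c w => (hc c w).symm) (Sum.inr b) (Sum.inr b')

theorem eq_of_vertexOf_eq {α : Type*} {y : T.AnyVertex → α} {x : W → α}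
    (hyx : ∀ c w, y ⟨c, T.vertexOf c (Sum.inl w)⟩ = x w) (w w' : W) : x w = x w' := by
  have hb : ∀ c d, d ≠ c → ∀ w, y ⟨c, T.vertexOf c (Sum.inr (T.cross d w))⟩ = x w := by
    intro c d hd w
    rw [T.vertexOf_cross hd, hyx]
  have hgr : ∀ b, y ⟨.green, T.vertexOf .green (Sum.inr b)⟩ =
      y ⟨.red, T.vertexOf .red (Sum.inr b)⟩ := by
    intro b
    have h1 := hb .green .blue (by decide) ((T.cross .blue).symm b)
    have h2 := hb .red .blue (by decide) ((T.cross .blue).symm b)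
    rw [Equiv.apply_symm_apply] at h1 h2
    rw [h1, h2]
  refine T.eq_of_cross_invariant
    (Sum.elim x (fun b => y ⟨.red, T.vertexOf .red (Sum.inr b)⟩)) (fun c w => ?_)
    (Sum.inl w) (Sum.inl w')
  simp only [Sum.elim_inl, Sum.elim_inr]
  by_cases hc : c = .red
  · subst hc
    rw [← hgr, hb _ _ (by decide)]
  · rw [hb _ _ hc]

end Trinity

namespace PlanarTrinity

open Trinity

variable {W B : Type*} (T : PlanarTrinity W B)

/-- On the sphere, a flow on the corners without sources is the difference of a potential of the
black triangles. -/
theorem exists_potential [Fintype W] [Fintype B] (g : W → Colour → ℚ)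
    (hw : ∀ w, ∑ c, g w c = 0)
    (hv : ∀ y : T.AnyVertex → ℚ, ∑ w, ∑ c, g w c * y ⟨c, T.vertexOf c (Sum.inl w)⟩ = 0) :
    ∃ h : B → ℚ, ∀ w c, g w c = h (T.cross c.next w) - h (T.cross c.prev w) := by
  classical
  have : Finite T.AnyVertex := inferInstanceAs (Finite (Σ c, T.Vertex c))
  have := Fintype.ofFinite T.AnyVertex
  have horth : ∀ f : W → Colour → ℚ, (∀ w, ∑ c, f w c = 0) →
      (∀ y : T.AnyVertex → ℚ, ∑ w, ∑ c, f w c * y ⟨c, T.vertexOf c (Sum.inl w)⟩ = 0) →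
      ∀ (h : B → ℚ) (y : T.AnyVertex → ℚ) (x : W → ℚ),
      (∀ w c, h (T.cross c.next w) - h (T.cross c.prev w) +
        (y ⟨c, T.vertexOf c (Sum.inl w)⟩ + x w) = f w c) →
      ∀ w c, y ⟨c, T.vertexOf c (Sum.inl w)⟩ + x w = 0 := by
    intro f hfw hfv h y x hf
    have h1 := T.sum_difference_mul_eq_zero h y x
    have h2 : ∑ w, ∑ c, f w c * (y ⟨c, T.vertexOf c (Sum.inl w)⟩ + x w) = 0 := by
      simp only [mul_add, Finset.sum_add_distrib, hfv, zero_add, ← Finset.sum_mul, hfw, zero_mul,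
        Finset.sum_const_zero]
    have h3 : ∑ w, ∑ c : Colour, (y ⟨c, T.vertexOf c (Sum.inl w)⟩ + x w) ^ 2 = 0 := by
      rw [← sub_eq_zero.2 (h2.trans h1.symm), ← Finset.sum_sub_distrib]
      refine Finset.sum_congr rfl fun w _ => ?_
      rw [← Finset.sum_sub_distrib]
      refine Finset.sum_congr rfl fun c _ => ?_
      rw [← hf w c]
      ring
    intro w c
    have h4 := (Finset.sum_eq_zero_iff_of_nonneg
      fun w _ => Finset.sum_nonneg fun c _ => sq_nonneg _).1 h3 w (Finset.mem_univ _)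
    have h5 := (Finset.sum_eq_zero_iff_of_nonneg fun c _ => sq_nonneg _).1 h4 c (Finset.mem_univ _)
    exact pow_eq_zero_iff two_ne_zero |>.1 h5
  let Ψ : ((B → ℚ) × (T.AnyVertex → ℚ) × (W → ℚ)) →ₗ[ℚ] ((W → Colour → ℚ) × ℚ × ℚ) :=
    { toFun := fun p => (fun w c => p.1 (T.cross c.next w) - p.1 (T.cross c.prev w) +
          (p.2.1 ⟨c, T.vertexOf c (Sum.inl w)⟩ + p.2.2 w),
        p.1 (T.cross .red T.outer), p.2.2 T.outer)
      map_add' := fun p q => by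
        ext <;> simp; ring
      map_smul' := fun r p => by
        ext <;> simp; ring }
  have hinj : Function.Injective Ψ := by
    rw [injective_iff_map_eq_zero]
    rintro ⟨h, y, x⟩ hΨ
    obtain ⟨h1, h2, h3⟩ : (∀ w c, h (T.cross c.next w) - h (T.cross c.prev w) +
        (y ⟨c, T.vertexOf c (Sum.inl w)⟩ + x w) = 0) ∧ h (T.cross .red T.outer) = 0 ∧
        x T.outer = 0 := by
      obtain ⟨h1, h2⟩ := Prod.ext_iff.1 hΨ
      exact ⟨fun w c => congrFun (congrFun h1 w) c, Prod.ext_iff.1 h2⟩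
    have hδ := horth 0 (by simp) (by simp) h y x h1
    have hh : h = 0 := by
      ext b
      rw [T.eq_of_difference_eq_zero (h := h) (fun c w => ?_) b (T.cross .red T.outer), h2]
      · rfl
      · have := h1 w c
        rw [hδ, add_zero] at this
        exact sub_eq_zero.1 this
    have hx : ∀ w, x w = 0 := by
      intro w
      have := T.eq_of_vertexOf_eq (y := fun v => - y v) (x := x)
        (fun c w => by have := hδ w c; linarith) w T.outer
      rw [this, h3]
    have hy : y = 0 := by
      ext ⟨c, v⟩
      obtain ⟨w, rfl⟩ := T.exists_white_vertexOf v
      have := hδ w c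
      rw [hx, add_zero] at this
      exact this
    rw [hh, hy, show x = 0 from funext hx]
    rfl
  have hsurj : Function.Surjective Ψ := by
    refine (LinearMap.injective_iff_surjective_of_finrank_eq_finrank ?_).1 hinj
    have hV := T.card_anyVertex
    have hB : Fintype.card B = Fintype.card W := (Fintype.card_congr (T.cross .red)).symm
    have hC : Fintype.card Colour = 3 := rfl
    rw [Nat.card_eq_fintype_card, Nat.card_eq_fintype_card] at hV
    simp only [Module.finrank_prod, Module.finrank_pi_fintype, Module.finrank_self,
      Finset.sum_const, Finset.card_univ, smul_eq_mul, mul_one, hV, hB, hC]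
    omega
  obtain ⟨⟨h, y, x⟩, hΨ⟩ := hsurj (g, 0, 0)
  have h1 : ∀ w c, h (T.cross c.next w) - h (T.cross c.prev w) +
      (y ⟨c, T.vertexOf c (Sum.inl w)⟩ + x w) = g w c :=
    fun w c => congrFun (congrFun (Prod.ext_iff.1 hΨ).1 w) c
  refine ⟨h, fun w c => ?_⟩
  rw [← h1 w c, horth g hw hv h y x h1, add_zero]

variable {T}

open Classical in
/-- The difference of two matchings has a height function. -/
theorem IsMatching.exists_height [Finite W] [Finite B] {M M' : W → Colour} (hM : T.IsMatching M)
    (hM' : T.IsMatching M') :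
    ∃ h : B → ℚ, ∀ w c, h (T.cross c.next w) - h (T.cross c.prev w) =
      if w = T.outer then 0 else (if M w = c then 1 else 0) - (if M' w = c then 1 else 0) := by
  have := Fintype.ofFinite W
  have := Fintype.ofFinite B
  have : Finite T.AnyVertex := inferInstanceAs (Finite (Σ c, T.Vertex c))
  have := Fintype.ofFinite T.AnyVertex
  obtain ⟨h, hh⟩ := T.exists_potential (fun w c => if w = T.outer then 0 else
    (if M w = c then 1 else 0) - (if M' w = c then 1 else 0))
    (fun w => by
      by_cases hw : w = T.outer
      · simp [hw]
      · simp only [hw, if_false, Finset.sum_sub_distrib]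
        simp)
    (fun y => by
      have key : ∀ M : W → Colour, T.IsMatching M → ∑ w, ∑ c, (if w = T.outer then 0 else
          if M w = c then (1 : ℚ) else 0) * y ⟨c, T.vertexOf c (Sum.inl w)⟩ =
          ∑ v : T.AnyVertex with v.2 ≠ T.root v.1, y v := by
        intro M hM
        have h1 : ∀ w, ∑ c, (if w = T.outer then 0 else
            if M w = c then (1 : ℚ) else 0) * y ⟨c, T.vertexOf c (Sum.inl w)⟩ =
            if w ≠ T.outer then y (T.matchVertex M w) else 0 := by
          intro w
          by_cases hw : w = T.outer
          · simp [hw]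
          · simp [hw, matchVertex]
        simp only [h1]
        rw [← Finset.sum_filter]
        refine Finset.sum_bij (fun w _ => T.matchVertex M w) ?_ ?_ ?_ fun _ _ => rfl
        · intro w hw
          simpa using hM.mapsTo (by simpa using hw)
        · intro w hw w' hw' e
          exact hM.injOn (by simpa using hw) (by simpa using hw') e
        · intro v hv
          obtain ⟨w, hw, e⟩ := hM.surjOn (by simpa using hv)
          exact ⟨w, by simpa using hw, e⟩
      have hsub := sub_eq_zero.2 ((key M hM).trans (key M' hM').symm)
      rw [← Finset.sum_sub_distrib] at hsub
      refine Eq.trans ?_ hsub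
      refine Finset.sum_congr rfl fun w _ => ?_
      rw [← Finset.sum_sub_distrib]
      refine Finset.sum_congr rfl fun c _ => ?_
      by_cases hw : w = T.outer
      · simp [hw]
      · simp only [hw, if_false, sub_mul])
  exact ⟨h, fun w c => (hh w c).symm⟩

end PlanarTrinity

namespace PlanarTrinity

open Trinity

variable {W B : Type*} {T : PlanarTrinity W B} {c : Colour} [Finite W] [Finite B]

/-- No region away from the outer triangle is entered, counter-clockwise around its vertices, only
at corners that belong to the matching given by a clocked arborescence. -/
theorem eq_empty_of_entering {S : Set B} (hout : ∀ d, T.cross d T.outer ∉ S)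
    (hent : ∀ w d, T.cross (Colour.next d) w ∈ S → T.cross (Colour.prev d) w ∉ S →
      w ≠ T.outer ∧ T.matchColour c w = d) : S = ∅ := by
  by_contra hS
  obtain ⟨b, hb, hmin⟩ := Set.exists_min_image S (fun b => T.time c (Sum.inr b)) (Set.toFinite _)
    (Set.nonempty_iff_ne_empty.2 hS)
  have hparent : ∀ x, T.cross c.prev x ∈ S → T.cross c.next x ∉ S →
      ∃ w ∈ T.clocked c, T.head c x = T.head c w ∧ x ≠ w ∧
        T.time c (Sum.inr b) ≤ T.time c (Sum.inr (T.cross c w)) + 1 := by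
    intro x h1 h2
    obtain ⟨w, hw, h3, h4⟩ := T.exists_entering_of_leaving h1 h2
    have hA := matchColour_eq_self_iff.1 (hent w c h3 h4).2
    refine ⟨w, hA, hw.symm, by rintro rfl; exact h2 h3, (hmin _ h3).trans ?_⟩
    have := time_perimeterStep_le (T := T) (c := c) (Sum.inr (T.cross c w))
    simpa [perimeterStep, hA] using this
  have hdescent : ∀ n x, T.cross c.next x ∈ S → T.cross c x ∉ S →
      T.time c (Sum.inr (T.cross c x)) = n → n < T.time c (Sum.inr b) → False := by
    intro n
    induction n using Nat.strong_induction_on with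
    | _ n ih =>
      intro x h1 h2 hn hlt
      obtain ⟨w, hv, h3, h4⟩ := T.exists_entering_of_leaving (c := c.prev) (S := S) (w := x)
        (by simpa using h1) (by simpa using h2)
      obtain ⟨hwo, hwm⟩ := hent w _ h3 h4
      rw [Colour.prev_next] at h3
      rw [Colour.prev_prev] at h4
      have ht := time_lt_black hwo hwm (b := T.cross c x)
        ((T.vertexOf_cross c.prev_ne.symm x).trans hv.symm)
      by_cases h5 : T.cross c.prev w ∈ S
      · obtain ⟨w', hw', he, -, hle⟩ := hparent w h5 h4
        have := time_tail_lt hw' (h := Sum.inl w) he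
        omega
      · obtain ⟨w', hv', h6, h7⟩ := T.exists_entering_of_leaving (c := c.next) (S := S) (w := w)
          (by simpa using h3) (by simpa using h5)
        obtain ⟨hwo', hwm'⟩ := hent w' _ h6 h7
        rw [Colour.next_next] at h6
        rw [Colour.next_prev] at h7
        have ht' := time_lt_white hwo' hwm' hv'.symm
        by_cases h8 : T.cross c.next w' ∈ S
        · exact ih _ (by omega) w' h8 h7 rfl (by omega)
        · obtain ⟨w'', hw'', he, hne, hle⟩ := hparent w' h6 h8
          have := time_tail_lt_of_head_eq hw'' hne he
          omega
  obtain ⟨w, rfl⟩ := (T.cross c.next).surjective b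
  have hnot : ∀ b', T.time c (Sum.inr b') < T.time c (Sum.inr (T.cross c.next w)) → b' ∉ S :=
    fun b' hlt hb' => (hmin b' hb').not_gt hlt
  obtain ⟨h', hstep, htime⟩ := exists_perimeterStep_eq (T := T) (c := c)
    (h := Sum.inr (T.cross c.next w)) (by simp)
  rcases T.eq_of_perimeterStep_eq_inr hstep with ⟨hA, rfl⟩ | ⟨hA, rfl⟩
  · exact hdescent _ w hb (hnot _ (by omega)) rfl (by omega)
  · have hwo : (Sum.inl w : W ⊕ B) ≠ Sum.inl T.outer := by
      rintro ⟨⟩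
      exact hout _ hb
    obtain ⟨h'', hstep', htime'⟩ := exists_perimeterStep_eq (T := T) (c := c) hwo
    obtain ⟨w', hw', hcase⟩ := T.eq_of_perimeterStep_eq_inl hstep'
    refine hA (matchColour_eq_self_iff.1 (hent w c hb ?_).2)
    rw [← hw']
    rcases hcase with ⟨hA', rfl⟩ | ⟨-, rfl⟩
    · have := time_tail_lt hA' (h := Sum.inl w') rfl
      exact hnot _ (by omega)
    · exact hnot _ (by omega)

/-- The matchings given by the three clocked arborescences agree. -/
theorem matchColour_eq (c c' : Colour) {w : W} (hw : w ≠ T.outer) :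
    T.matchColour c w = T.matchColour c' w := by
  classical
  obtain ⟨h, hh⟩ := (isMatching_matchColour (T := T) c).exists_height (isMatching_matchColour c')
  have hout : ∀ d, h (T.cross d T.outer) = h (T.cross .red T.outer) := by
    have h1 := hh T.outer .green
    have h2 := hh T.outer .blue
    simp only [if_true, Colour.next, Colour.prev, sub_eq_zero] at h1 h2
    rintro (_ | _ | _)
    exacts [rfl, h2, h1.symm]
  have hpos := eq_empty_of_entering (T := T) (c := c) (S := {b | h (T.cross .red T.outer) < h b})
    (fun d => by simp [hout]) (fun w d h1 h2 => by
      have := hh w d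
      simp only [Set.mem_ofPred_eq, not_lt] at h1 h2
      split_ifs at this with e1 e2 e3 <;> first | exact ⟨e1, e2⟩ | (exfalso; linarith))
  have hneg := eq_empty_of_entering (T := T) (c := c') (S := {b | h b < h (T.cross .red T.outer)})
    (fun d => by simp [hout]) (fun w d h1 h2 => by
      have := hh w d
      simp only [Set.mem_ofPred_eq, not_lt] at h1 h2
      split_ifs at this with e1 e2 e3 e3 <;> first | exact ⟨e1, e3⟩ | (exfalso; linarith))
  have hconst : ∀ b, h b = h (T.cross .red T.outer) := fun b =>
    le_antisymm (not_lt.1 fun hlt => (Set.ext_iff.1 hpos b).1 hlt)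
      (not_lt.1 fun hlt => (Set.ext_iff.1 hneg b).1 hlt)
  have := hh w (T.matchColour c w)
  rw [hconst (T.cross _ w), hconst (T.cross (Colour.prev _) w), sub_self, if_neg hw, if_pos rfl] at this
  by_contra hne
  rw [if_neg (Ne.symm hne)] at this
  norm_num at this

theorem mem_iUnion_asMatching {w : W} {v : T.AnyVertex} :
    (w, v) ∈ ⋃ c : Colour, T.asMatching c (T.clocked c) ↔
      w ≠ T.outer ∧ T.matchVertex (T.matchColour .red) w = v := by
  obtain ⟨d, v⟩ := v
  rw [Set.mem_iUnion, matchVertex_eq_iff]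
  constructor
  · rintro ⟨c, w', hw', e⟩
    rw [Prod.mk_inj, Sigma.mk.inj_iff] at e
    obtain ⟨rfl, rfl, e⟩ := e
    obtain rfl := eq_of_heq e
    have hne : w ≠ T.outer := by
      rintro rfl
      exact head_ne_root_of_mem_clocked hw' rfl
    exact ⟨hne, (matchColour_eq _ _ hne).trans (matchColour_eq_self_iff.2 hw'), rfl⟩
  · rintro ⟨hne, hm, rfl⟩
    refine ⟨d, w, matchColour_eq_self_iff.1 ((matchColour_eq _ _ hne).trans hm), rfl⟩

end PlanarTrinity

theorem corollary4p8 {W B : Type*} [Finite W] [Finite B] (T : PlanarTrinity W B) :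
    (∀ c : Colour, T.IsSpanningArborescence c (T.clocked c)) ∧
      T.IsTutteMatching (⋃ c : Colour, T.asMatching c (T.clocked c)) := by
  have hM := PlanarTrinity.isMatching_matchColour (T := T) .red
  refine ⟨T.isSpanningArborescence_clocked, ?_, ?_, ?_⟩
  · rintro ⟨w, v⟩ hp
    obtain ⟨hw, rfl⟩ := PlanarTrinity.mem_iUnion_asMatching.1 hp
    exact ⟨hw, hM.mapsTo hw, rfl⟩
  · intro w hw
    exact ⟨_, PlanarTrinity.mem_iUnion_asMatching.2 ⟨hw, rfl⟩,
      fun v hv => (PlanarTrinity.mem_iUnion_asMatching.1 hv).2.symm⟩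
  · intro v hv
    obtain ⟨w, hw, e⟩ := hM.surjOn hv
    refine ⟨w, PlanarTrinity.mem_iUnion_asMatching.2 ⟨hw, e⟩, fun w' hw' => ?_⟩
    obtain ⟨hw', e'⟩ := PlanarTrinity.mem_iUnion_asMatching.1 hw'
    exact hM.injOn hw' hw (e'.trans e.symm)
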